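/- Let $\mathbb{A}$ be a partial combinatory algebra with application $u\cdot v$. An assembly $X$ is a set $\Gamma X$ with a non-empty set $E_X(x)\subseteq\mathbb{A}$ of realizers for each $x\in\Gamma X$; a morphism $X\to Y$ is a function $f:\Gamma X\to\Gamma Y$ for which some $u\in\mathbb{A}$ satisfies $u\cdot v\in E_Y(f(x))$ (in particular, is defined) for all $x\in\Gamma X$ and $v\in E_X(x)$. Statements about types are interpreted in assemblies: a dependent type over $X$ is a family of assemblies indexed by $\Gamma X$; $\prod$ consists of the (uniformly) realized sections; $\sum$ consists of pairs, realized by pairs of realizers; $\mathrm{Id}_X(x,y)$ is the subterminal assembly that is inhabited iff $x=y$; "there exists" is read as $\sum$; and a closed type holds when it has a global element. A function is an equivalence if each of its fibers $\sum_{x}\mathrm{Id}(f x,y)$ is contractible. A universe $\mathcal{U}$ is an assembly with a dependent assembly $\mathrm{El}_{\mathcal U}$ over it, which is left implicit; $X\in\mathcal{U}$ means that there are a code $A:\mathcal{U}$ and an equivalence $\mathrm{El}_{\mathcal U}A\simeq X$, and $\mathcal{U}\subseteq\mathcal{V}$ means that $\mathrm{El}_{\mathcal U}A\in\mathcal{V}$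 for all $A:\mathcal{U}$. For a universe $V$ of the ambient set theory in which $\mathbb{A}$ is small, let $\mathcal{V}$ be the universe whose codes are the assemblies $X$ with $\Gamma X\in V$, each code being realized by all of $\mathbb{A}$, with $\mathrm{El}_{\mathcal V}X=X$. Let $\mathcal{U}$ be the universe whose codes are the partial equivalence relations (symmetric transitive relations) $R$ on $\mathbb{A}$, each code being realized by all of $\mathbb{A}$, where $\mathrm{El}_{\mathcal U}R$ is the modest set $M_R$ of $R$-equivalence classes, each class being realized by its members. Then, for every such $V$: 1. $\mathcal{U}\in\mathcal{V}$ and $\mathcal{U}\subseteq\mathcal{V}$. 2. $\mathcal{U}$ is closed under equality types: for all $A:\mathcal{U}$ and $x,y:A$ we have $\mathrm{Id}_A(x,y)\in\mathcal{U}$. 3. $\mathcal{U}$ has universal types: for all $A:\mathcal{V}$ and $B:A\to\mathcal{U}$ we have $\prod_{x:A}B(x)\in\mathcal{U}$. 4. $\mathcal{U}$ is a small reflective subuniverse of $\mathcal{V}$. That is, 1 holds; the (propositionally truncated) predicate $A\in\mathcal{U}$ on $A:\mathcal{V}$ is a proposition and is replete (if $A\simeq B$ and $B\in\mathcal{U}$,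 then $A\in\mathcal{U}$); and for every $A:\mathcal{V}$ there are $M:\mathcal{U}$ and $\eta:A\to M$ such that precomposition $(M\to B)\to(A\to B)$ with $\eta$ is an equivalence for every $B:\mathcal{U}$. The same reflection property holds with $\mathcal{U}$ replaced by the universe $\{A:\mathcal{V}\mid A\in\mathcal{U}\}$. 5. Hence $(\mathcal{U},\mathcal{V})$ is a model of first-class modules with types $\mathcal{U}$ and signatures $\mathcal{V}$: $\mathcal{U}\in\mathcal{V}$; $\mathcal{U}\subseteq\mathcal{V}$; $\mathcal{V}$ is closed under dependent sums and dependent products; and there are an operation $\Diamond:\mathcal{V}\to\mathcal{U}$, units $\eta_A:A\to\Diamond A$ and eliminators $\mathrm{bind}_{A,C}:(A\to C)\to(\Diamond A\to C)$ for $A:\mathcal{V}$ and $C:\mathcal{U}$, such that $\mathrm{bind}\,v\,(\eta_A x)=v\,x$ for all $v:A\to C$ and $x:A$, and any $f,g:\Diamond A\to C$ with $f(\eta_A x)=g(\eta_A x)$ for all $x:A$ agree on all of $\Diamond A$. -/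

import Mathlib

universe u a b c d w

namespace Realizability

/-- A partial combinatory algebra: a set with a partial binary application and elements `k`, `s`
such that `k·x·y = x`, `s·x·y` is defined, and `s·x·y·z ≃ (x·z)·(y·z)` (Kleene equality). -/
class PCA (𝔸 : Type u) where
  app : 𝔸 → 𝔸 → Part 𝔸
  k : 𝔸
  s : 𝔸
  k_app : ∀ x y, ((app k x).bind fun p => app p y) = Part.some x
  s_dom : ∀ x y, ((app s x).bind fun p => app p y).Dom
  s_app : ∀ x y z, (((app s x).bind fun p => app p y).bind fun q => app q z) =
    (app x z).bind fun p => (app y z).bind fun q => app p q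

/-! ### Elementary combinators -/

namespace PCA

variable {𝔸 : Type u} [PCA 𝔸]

theorem exists_k (x : 𝔸) : ∃ p ∈ app k x, ∀ y, app p y = Part.some x := by
  have h : x ∈ (app k x).bind fun p => app p x := by rw [k_app]; exact Part.mem_some x
  obtain ⟨p, hp, -⟩ := Part.mem_bind_iff.1 h
  refine ⟨p, hp, fun y => ?_⟩
  have h2 := k_app x y
  rwa [Part.eq_some_iff.2 hp, Part.bind_some] at h2

theorem exists_s (x y : 𝔸) : ∃ p ∈ app s x, ∃ q ∈ app p y,
    ∀ z, app q z = (app x z).bind fun p => (app y z).bind fun q => app p q := by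
  obtain ⟨p, hp, hq⟩ := Part.mem_bind_iff.1 (Part.get_mem (s_dom x y))
  refine ⟨p, hp, _, hq, fun z => ?_⟩
  have h2 := s_app x y z
  rwa [Part.eq_some_iff.2 hp, Part.bind_some, Part.eq_some_iff.2 hq, Part.bind_some] at h2

/-- `s·x·y` as an element. -/
noncomputable def ss (x y : 𝔸) : 𝔸 := ((app s x).bind fun p => app p y).get (s_dom x y)

theorem ss_app (x y z : 𝔸) :
    app (ss x y) z = (app x z).bind fun p => (app y z).bind fun q => app p q := by
  obtain ⟨p, hp, q, hq, h⟩ := exists_s x y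
  have : ss x y = q := Part.get_eq_of_mem (Part.mem_bind hp hq) _
  rw [this, h]

/-- `k·x` as an element. -/
noncomputable def kk (x : 𝔸) : 𝔸 := (exists_k x).choose

theorem kk_mem (x : 𝔸) : app k x = Part.some (kk x) :=
  Part.eq_some_iff.2 (exists_k x).choose_spec.1

theorem kk_app (x y : 𝔸) : app (kk x) y = Part.some x := (exists_k x).choose_spec.2 y

/-- The identity combinator `i = s·k·k`. -/
noncomputable def i (𝔸 : Type u) [PCA 𝔸] : 𝔸 := ss k k

theorem i_app (x : 𝔸) : app (i 𝔸) x = Part.some x := by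
  simp [i, ss_app, kk_mem, kk_app]

/-- The second Boolean `k̄ = k·i`, with `k̄·x·y = y`. -/
noncomputable def kbar (𝔸 : Type u) [PCA 𝔸] : 𝔸 := kk (i 𝔸)

/-- Pairs exist: `p = λ z. z·x·y` has `p·k = x` and `p·k̄ = y`. -/
theorem exists_pair (x y : 𝔸) : ∃ p : 𝔸, x ∈ app p k ∧ y ∈ app p (kbar 𝔸) := by
  refine ⟨ss (ss (i 𝔸) (kk x)) (kk y), ?_, ?_⟩
  · simp [ss_app, i_app, kk_app, kk_mem]
  · simp [ss_app, i_app, kk_app, kbar]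

/-- Composition is realized: some `r` has `r·h·x ≃ h·y` whenever `y = f·x`. -/
theorem exists_precomp (f : 𝔸) : ∃ r : 𝔸, ∀ h, ∃ q ∈ app r h,
    ∀ x, ∀ y ∈ app f x, app q x = app h y := by
  refine ⟨ss (ss (kk s) k) (kk f), fun h => ?_⟩
  obtain ⟨p, hp, q, hq, H⟩ := exists_s (kk h) f
  refine ⟨q, ?_, fun x y hy => ?_⟩
  · simpa [ss_app, kk_app, kk_mem, Part.eq_some_iff.2 hp] using hq
  · rw [H, kk_app, Part.bind_some, Part.eq_some_iff.2 hy, Part.bind_some]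

end PCA

open PCA

/-! ### Assemblies and partial equivalence relations -/

/-- An assembly: a set together with a non-empty set of realizers for each element. -/
structure Assembly (𝔸 : Type u) [PCA 𝔸] where
  carrier : Type a
  E : carrier → Set 𝔸
  E_nonempty : ∀ x, (E x).Nonempty

instance {𝔸 : Type u} [PCA 𝔸] : CoeSort (Assembly.{u, a} 𝔸) (Type a) := ⟨Assembly.carrier⟩

/-- A partial equivalence relation on the combinatory algebra. -/
structure PER (𝔸 : Type u) where
  rel : 𝔸 → 𝔸 → Prop
  symm : ∀ {x y}, rel x y → rel y x
  trans : ∀ {x y z}, rel x y → rel y z → rel x z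

/-- The total equivalence relation induced by a PER on its domain. -/
def PER.setoid {𝔸 : Type u} (R : PER 𝔸) : Setoid {x : 𝔸 // R.rel x x} where
  r x y := R.rel x.1 y.1
  iseqv := ⟨fun x => x.2, fun h => R.symm h, fun h h' => R.trans h h'⟩

variable {𝔸 : Type u} [PCA 𝔸]

/-- The modest set determined by a PER: its elements are the equivalence classes, and the
realizers of a class are its members. -/
def PER.modestSet (R : PER 𝔸) : Assembly.{u, u} 𝔸 where
  carrier := Quotient R.setoid
  E x := {v | ∃ h : R.rel v v, Quotient.mk R.setoid ⟨v, h⟩ = x}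
  E_nonempty x := by
    induction x using Quotient.ind with
    | _ v => exact ⟨v.1, v.2, rfl⟩

namespace Assembly

/-! ### The type formers of the internal type theory

A dependent assembly over `X` is a family `Y : X → Assembly 𝔸`. -/

/-- The terminal assembly. -/
def one (𝔸 : Type u) [PCA 𝔸] : Assembly.{u, 0} 𝔸 where
  carrier := PUnit
  E _ := Set.univ
  E_nonempty _ := ⟨k, trivial⟩

/-- Dependent product: the sections that have a realizer `r` such that, for every `x` and every
realizer `v` of `x`, `r·v` is defined and realizes the value at `x`. -/
def Pi (X : Assembly.{u, a} 𝔸) (Y : X → Assembly.{u, b} 𝔸) : Assembly.{u, max a b} 𝔸 where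
  carrier := {f : ∀ x : X, Y x // ∃ r : 𝔸, ∀ x, ∀ v ∈ X.E x, ∃ y ∈ app r v, y ∈ (Y x).E (f x)}
  E f := {r | ∀ x, ∀ v ∈ X.E x, ∃ y ∈ app r v, y ∈ (Y x).E (f.1 x)}
  E_nonempty f := f.2

instance (X : Assembly.{u, a} 𝔸) (Y : X → Assembly.{u, b} 𝔸) :
    CoeFun (Pi X Y) (fun _ => ∀ x : X, Y x) := ⟨fun f => f.1⟩

/-- The assembly of morphisms `X → Y`; its elements are exactly the morphisms of assemblies. -/
abbrev Fun (X : Assembly.{u, a} 𝔸) (Y : Assembly.{u, b} 𝔸) : Assembly.{u, max a b} 𝔸 :=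
  Pi X fun _ => Y

/-- Dependent sum: pairs, realized by (codes of) pairs of realizers. -/
def Sigma (X : Assembly.{u, a} 𝔸) (Y : X → Assembly.{u, b} 𝔸) : Assembly.{u, max a b} 𝔸 where
  carrier := Σ x : X, Y x
  E p := {r | (∃ v ∈ app r k, v ∈ X.E p.1) ∧ ∃ v ∈ app r (kbar 𝔸), v ∈ (Y p.1).E p.2}
  E_nonempty p := by
    obtain ⟨v, hv⟩ := X.E_nonempty p.1
    obtain ⟨v', hv'⟩ := (Y p.1).E_nonempty p.2
    obtain ⟨r, h, h'⟩ := exists_pair v v'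
    exact ⟨r, ⟨v, h, hv⟩, v', h', hv'⟩

/-- Binary product. -/
abbrev Prod (X : Assembly.{u, a} 𝔸) (Y : Assembly.{u, b} 𝔸) : Assembly.{u, max a b} 𝔸 :=
  Sigma X fun _ => Y

/-- Identification type: the subterminal assembly of proofs that `x = y`. -/
def Id (X : Assembly.{u, a} 𝔸) (x y : X) : Assembly.{u, 0} 𝔸 where
  carrier := PLift (x = y)
  E _ := Set.univ
  E_nonempty _ := ⟨k, trivial⟩

/-- Propositional truncation: realized by the realizers of all elements. -/
def Trunc (X : Assembly.{u, a} 𝔸) : Assembly.{u, 0} 𝔸 where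
  carrier := PLift (Nonempty X)
  E _ := {r | ∃ x, r ∈ X.E x}
  E_nonempty h := h.down.elim fun x => (X.E_nonempty x).imp fun _ hr => ⟨x, hr⟩

/-- A closed type of the internal type theory holds when it has a global element `1 → X`. -/
def Holds (X : Assembly.{u, a} 𝔸) : Prop := Nonempty (Fun (one 𝔸) X)

/-! ### Propositions, contractibility, fibers, equivalences -/

def IsProp (X : Assembly.{u, a} 𝔸) : Assembly.{u, a} 𝔸 :=
  Pi X fun x => Pi X fun y => Id X x y

def IsContr (X : Assembly.{u, a} 𝔸) : Assembly.{u, a} 𝔸 :=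
  Sigma X fun x => Pi X fun y => Id X y x

def Fib {X : Assembly.{u, a} 𝔸} {Y : Assembly.{u, b} 𝔸} (f : Fun X Y) (y : Y) :
    Assembly.{u, a} 𝔸 :=
  Sigma X fun x => Id Y (f x) y

def IsEquiv {X : Assembly.{u, a} 𝔸} {Y : Assembly.{u, b} 𝔸} (f : Fun X Y) :
    Assembly.{u, max a b} 𝔸 :=
  Pi Y fun y => IsContr (Fib f y)

def Equiv (X : Assembly.{u, a} 𝔸) (Y : Assembly.{u, b} 𝔸) : Assembly.{u, max a b} 𝔸 :=
  Sigma (Fun X Y) fun f => IsEquiv f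

/-- Precomposition `(Y → Z) → (X → Z)` with a morphism `e : X → Y`. -/
def precomp {X : Assembly.{u, a} 𝔸} {Y : Assembly.{u, b} 𝔸} (e : Fun X Y)
    (Z : Assembly.{u, c} 𝔸) : Fun (Fun Y Z) (Fun X Z) :=
  have key : ∃ r : 𝔸, ∀ f : Fun Y Z, ∀ v ∈ (Fun Y Z).E f, ∃ q ∈ app r v,
      ∀ x, ∀ p ∈ X.E x, ∃ z ∈ app q p, z ∈ Z.E (f (e x)) := by
    obtain ⟨t, ht⟩ := e.2
    obtain ⟨r, hr⟩ := exists_precomp t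
    refine ⟨r, fun f v hv => ?_⟩
    obtain ⟨q, hq, H⟩ := hr v
    refine ⟨q, hq, fun x p hp => ?_⟩
    obtain ⟨y, hy, hy'⟩ := ht x p hp
    rw [H p y hy]
    exact hv (e x) y hy'
  ⟨fun f => ⟨fun x => f (e x), by
      obtain ⟨r, hr⟩ := key
      obtain ⟨v, hv⟩ := (Fun Y Z).E_nonempty f
      obtain ⟨q, -, H⟩ := hr f v hv
      exact ⟨q, H⟩⟩, key⟩

end Assembly

open Assembly

/-! ### Universes -/

/-- A universe: an assembly of codes with a dependent assembly over it. -/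
structure Univ (𝔸 : Type u) [PCA 𝔸] where
  ty : Assembly.{u, a} 𝔸
  El : ty → Assembly.{u, b} 𝔸

/-- The universe of `w`-small assemblies; every code is realized by every element. -/
def asmUniv (𝔸 : Type u) [PCA 𝔸] : Univ.{u, max u (w + 1), w} 𝔸 where
  ty := { carrier := Assembly.{u, w} 𝔸
          E := fun _ => Set.univ
          E_nonempty := fun _ => ⟨k, trivial⟩ }
  El X := X

/-- The universe of partial equivalence relations; every code is realized by every element. -/
def perUniv (𝔸 : Type u) [PCA 𝔸] : Univ.{u, u, u} 𝔸 where
  ty := { carrier := PER 𝔸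
          E := fun _ => Set.univ
          E_nonempty := fun _ => ⟨k, trivial⟩ }
  El R := R.modestSet

namespace Univ

/-- `X ∈ 𝒰`: there is a code in `𝒰` with an equivalence from its decoding to `X`. -/
def Has (U : Univ.{u, a, b} 𝔸) (X : Assembly.{u, c} 𝔸) : Assembly.{u, max a b c} 𝔸 :=
  Sigma U.ty fun A => Equiv (U.El A) X

/-- `𝒰 ⊆ 𝒱`: every type of `𝒰` is in `𝒱`. -/
def Subset (U : Univ.{u, a, b} 𝔸) (V : Univ.{u, c, d} 𝔸) : Assembly.{u, max a b c d} 𝔸 :=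
  Pi U.ty fun A => V.Has (U.El A)

/-- `𝒰` is closed under identification types. -/
def ClosedUnderId (U : Univ.{u, a, b} 𝔸) : Assembly.{u, max a b} 𝔸 :=
  Pi U.ty fun A => Pi (U.El A) fun x => Pi (U.El A) fun y => U.Has (Id (U.El A) x y)

/-- `𝒰` has universal types with respect to `𝒱`: for all `A : 𝒱` and `B : A → 𝒰`, the dependent
product of `B` is in `𝒰`. With `𝒰 = 𝒱` this is closure of `𝒱` under dependent products. -/
def UniversalTypes (U : Univ.{u, a, b} 𝔸) (V : Univ.{u, c, d} 𝔸) :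
    Assembly.{u, max a b c d} 𝔸 :=
  Pi V.ty fun A => Pi (Fun (V.El A) U.ty) fun B => U.Has (Pi (V.El A) fun x => U.El (B x))

/-- `𝒱` is closed under dependent sums. -/
def ClosedUnderSigma (V : Univ.{u, c, d} 𝔸) : Assembly.{u, max c d} 𝔸 :=
  Pi V.ty fun A => Pi (Fun (V.El A) V.ty) fun B => V.Has (Sigma (V.El A) fun x => V.El (B x))

/-- `𝒰` reflects `X`: there are a code `M : 𝒰` and a unit `η : X → M` such that precomposition
`(M → B) → (X → B)` with `η` is an equivalence for every `B : 𝒰`. -/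
def Reflects (U : Univ.{u, a, b} 𝔸) (X : Assembly.{u, c} 𝔸) : Assembly.{u, max a b c} 𝔸 :=
  Sigma U.ty fun M => Sigma (Fun X (U.El M)) fun η =>
    Pi U.ty fun B => IsEquiv (precomp η (U.El B))

/-- Every type of `𝒱` is reflected in `𝒰`. -/
def Reflective (U : Univ.{u, a, b} 𝔸) (V : Univ.{u, c, d} 𝔸) : Assembly.{u, max a b c d} 𝔸 :=
  Pi V.ty fun A => U.Reflects (V.El A)

/-- A predicate on `𝒱` is a subuniverse if its values are propositions and it is replete. -/
def IsSubuniverse (V : Univ.{u, c, d} 𝔸) (P : V.ty → Assembly.{u, a} 𝔸) :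
    Assembly.{u, max a c d} 𝔸 :=
  Prod (Pi V.ty fun A => IsProp (P A))
    (Pi V.ty fun A => Pi V.ty fun B => Fun (Equiv (V.El A) (V.El B)) (Fun (P B) (P A)))

/-- The universe of those types of `𝒱` that satisfy a predicate. -/
def sub (V : Univ.{u, c, d} 𝔸) (P : V.ty → Assembly.{u, a} 𝔸) : Univ.{u, max c a, d} 𝔸 where
  ty := Sigma V.ty P
  El p := V.El p.1

/-- The proposition `A ∈ 𝒰` for `A : 𝒱`. -/
def memPred (U : Univ.{u, a, b} 𝔸) (V : Univ.{u, c, d} 𝔸) (A : V.ty) : Assembly.{u, 0} 𝔸 :=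
  Trunc (U.Has (V.El A))

/-- `𝒰` is a small reflective subuniverse of `𝒱`: it is an element of `𝒱` and contained in `𝒱`,
membership in `𝒰` defines a subuniverse of `𝒱`, and every type of `𝒱` is reflected both in `𝒰`
and in the universe of those types of `𝒱` that belong to `𝒰`. -/
structure IsSmallReflectiveSubuniverse (U : Univ.{u, a, b} 𝔸) (V : Univ.{u, c, d} 𝔸) :
    Prop where
  small : Holds (V.Has U.ty)
  subset : Holds (U.Subset V)
  subuniverse : Holds (V.IsSubuniverse (U.memPred V))
  reflective : Holds (U.Reflective V)
  reflective_sub : Holds ((V.sub (U.memPred V)).Reflective V)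

/-- The rules of the module modality, with signatures in `𝒱` and types in `𝒰`: formation `mod`,
introduction `η`, elimination `bind`, and the computation and extensionality rules of `bind`. -/
def ModalRules (U : Univ.{u, a, b} 𝔸) (V : Univ.{u, c, d} 𝔸) : Assembly.{u, max a b c d} 𝔸 :=
  Sigma (Fun V.ty U.ty) fun mod =>
  Sigma (Pi V.ty fun A => Fun (V.El A) (U.El (mod A))) fun η =>
  Sigma (Pi V.ty fun A => Pi U.ty fun C =>
    Fun (Fun (V.El A) (U.El C)) (Fun (U.El (mod A)) (U.El C))) fun bind =>
  Prod
    (Pi V.ty fun A => Pi U.ty fun C => Pi (Fun (V.El A) (U.El C)) fun v => Pi (V.El A) fun x =>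
      Id (U.El C) (bind A C v (η A x)) (v x))
    (Pi V.ty fun A => Pi U.ty fun C =>
      Pi (Fun (U.El (mod A)) (U.El C)) fun f => Pi (Fun (U.El (mod A)) (U.El C)) fun g =>
        Fun (Pi (V.El A) fun x => Id (U.El C) (f (η A x)) (g (η A x)))
          (Pi (U.El (mod A)) fun z => Id (U.El C) (f z) (g z)))

/-- `(𝒰, 𝒱)` is a model of first-class modules, with signatures interpreted in `𝒱` and types in
`𝒰`: the types form a signature, every type is a signature, signatures are closed under dependent
sums and products, and the rules of the module modality hold. -/
structure ModelsFirstClassModules (U : Univ.{u, a, b} 𝔸) (V : Univ.{u, c, d} 𝔸) : Prop where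
  small : Holds (V.Has U.ty)
  subset : Holds (U.Subset V)
  sigma : Holds V.ClosedUnderSigma
  pi : Holds (V.UniversalTypes V)
  modal : Holds (U.ModalRules V)

end Univ

end Realizability

/-! Up to equivalence, the types of `perUniv` are exactly the modest assemblies, those in which a
realizer determines its element (`Modest.perUniv_has`, `modest_of_perUniv_has`). Modesty holds for
subterminal assemblies and passes to products over arbitrary index assemblies, which gives
identification types and universal types.

A morphism into a modest assembly identifies elements that share a realizer. So the reflection of
`X` is its quotient by the equivalence relation generated by sharing, with the same realizers, coded
by `toPER`. The unit is tracked by `i`, and an extension along it keeps the realizer of the original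
morphism, so the inverse of precomposition is tracked by `i` as well
(`IsModestQuotient.precomp_isEquiv_realizedBy`).

Codes carry no computational information, so everything must be realized uniformly in them. This is
why the lemmas prove `RealizedBy` with a fixed realizer, while the codes themselves are chosen in
the metatheory. Smallness of `𝔸` enters only to place PERs and their quotients in `asmUniv`. -/

namespace Realizability

/-! ### Pairing combinators -/

namespace PCA

variable {𝔸 : Type u} [PCA 𝔸]

/-- The term `λ v. ⟨r·v, c⟩` is represented. -/
theorem exists_pair_app_const (r c : 𝔸) : ∃ q : 𝔸, ∀ v, ∀ y ∈ app r v,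
    ∃ p ∈ app q v, y ∈ app p k ∧ c ∈ app p (kbar 𝔸) := by
  obtain ⟨si, hsi, -⟩ := exists_s (i 𝔸) (i 𝔸)
  -- Bracket abstraction of `λ v. s·(s·i·(k·(r·v)))·(k·c)`; the inner term maps `z` to `z·(r·v)·c`,
  -- the usual pairing.
  refine ⟨ss (ss (kk s) (ss (kk si) (ss (kk k) r))) (kk (kk c)), fun v y hy => ?_⟩
  obtain ⟨si', hsi', a, ha, ha'⟩ := exists_s (i 𝔸) (kk y)
  obtain rfl := Part.mem_unique hsi hsi'
  obtain ⟨sa, hsa, p, hp, hp'⟩ := exists_s a (kk c)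
  refine ⟨p, ?_, ?_, ?_⟩
  · simpa [ss_app, kk_app, kk_mem, Part.eq_some_iff.2 hy, Part.eq_some_iff.2 ha,
      Part.eq_some_iff.2 hsa] using hp
  · simp [hp', ha', i_app, kk_app, kk_mem]
  · simp [hp', ha', i_app, kk_app, kbar]

/-- A code of the pair of `x` and `y`. -/
noncomputable def pair (x y : 𝔸) : 𝔸 := (exists_pair x y).choose

theorem mem_pair_fst (x y : 𝔸) : x ∈ app (pair x y) k := (exists_pair x y).choose_spec.1

theorem mem_pair_snd (x y : 𝔸) : y ∈ app (pair x y) (kbar 𝔸) := (exists_pair x y).choose_spec.2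

/-- A code of `λ v. ⟨r·v, c⟩`. -/
noncomputable def pairConst (r c : 𝔸) : 𝔸 := (exists_pair_app_const r c).choose

theorem pairConst_spec (r c : 𝔸) {v y : 𝔸} (hy : y ∈ app r v) :
    ∃ p ∈ app (pairConst r c) v, y ∈ app p k ∧ c ∈ app p (kbar 𝔸) :=
  (exists_pair_app_const r c).choose_spec v y hy

theorem mem_kk_app (x y : 𝔸) : x ∈ app (kk x) y := by
  rw [kk_app]; exact Part.mem_some x

theorem mem_i_app (x : 𝔸) : x ∈ app (i 𝔸) x := by
  rw [i_app]; exact Part.mem_some x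

end PCA

open PCA

variable {𝔸 : Type u} [PCA 𝔸]

namespace Assembly

/-! ### Inhabitation by a given realizer -/

/-- `r` realizes some element of `X`. -/
def RealizedBy (X : Assembly.{u, a} 𝔸) (r : 𝔸) : Prop := ∃ x, r ∈ X.E x

theorem RealizedBy.holds {X : Assembly.{u, a} 𝔸} {r : 𝔸} (h : X.RealizedBy r) : X.Holds := by
  obtain ⟨x, hx⟩ := h
  exact ⟨⟨fun _ => x, kk r, fun _ v _ => ⟨r, mem_kk_app r v, hx⟩⟩⟩

theorem Holds.of_element {X : Assembly.{u, a} 𝔸} (x : X) : X.Holds := by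
  obtain ⟨r, hr⟩ := X.E_nonempty x
  exact RealizedBy.holds ⟨x, hr⟩

/-- The section may be chosen non-constructively: with one realizer common to all fibers, the
constant combinator tracks any such choice. -/
theorem RealizedBy.pi {X : Assembly.{u, a} 𝔸} {Y : X → Assembly.{u, b} 𝔸} {r : 𝔸}
    (h : ∀ x, (Y x).RealizedBy r) : (Pi X Y).RealizedBy (kk r) := by
  choose f hf using h
  have hr : ∀ x, ∀ v ∈ X.E x, ∃ y ∈ app (kk r) v, y ∈ (Y x).E (f x) :=
    fun x v _ => ⟨r, mem_kk_app r v, hf x⟩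
  exact ⟨⟨f, kk r, hr⟩, hr⟩

theorem RealizedBy.sigma {X : Assembly.{u, a} 𝔸} {Y : X → Assembly.{u, b} 𝔸} {r t : 𝔸} (x : X)
    (hx : r ∈ X.E x) (h : (Y x).RealizedBy t) : (Sigma X Y).RealizedBy (pair r t) := by
  obtain ⟨y, hy⟩ := h
  exact ⟨⟨x, y⟩, ⟨r, mem_pair_fst r t, hx⟩, t, mem_pair_snd r t, hy⟩

theorem RealizedBy.id {X : Assembly.{u, a} 𝔸} {x y : X} (h : x = y) (r : 𝔸) :
    (Id X x y).RealizedBy r := ⟨⟨h⟩, trivial⟩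

/-! ### Equivalences from inverse functions -/

theorem fib_ext {X : Assembly.{u, a} 𝔸} {Y : Assembly.{u, b} 𝔸} {f : Fun X Y} {y : Y}
    {p q : Fib f y} (h : p.1 = q.1) : p = q := by
  obtain ⟨x, ⟨hx⟩⟩ := p
  obtain ⟨x', ⟨hx'⟩⟩ := q
  obtain rfl : x = x' := h
  rfl

/-- A realizer of the statement that a function is an equivalence, computed from a realizer of an
inverse function. -/
noncomputable def isEquivRealizer (r : 𝔸) : 𝔸 := pairConst (pairConst r k) (kk k)

/-- The fiber over `y` is centered at `g y`. Identifications carry no information, so the realizer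
depends only on `r`, not on `f` or the assemblies. -/
theorem isEquiv_realizedBy {X : Assembly.{u, a} 𝔸} {Y : Assembly.{u, b} 𝔸} (f : Fun X Y)
    (g : Y → X) (hfg : ∀ y, f (g y) = y) (hgf : ∀ x, g (f x) = x) {r : 𝔸}
    (hr : ∀ y, ∀ v ∈ Y.E y, ∃ x ∈ app r v, x ∈ X.E (g y)) :
    (IsEquiv f).RealizedBy (isEquivRealizer r) := by
  let center (y : Y) : Fib f y := ⟨g y, ⟨hfg y⟩⟩
  have unique (y : Y) (p : Fib f y) : p = center y := fib_ext (by
    obtain ⟨x, ⟨hx⟩⟩ := p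
    obtain rfl : f x = y := hx
    exact (hgf x).symm)
  have hc (y : Y) : ∀ p : Fib f y, ∀ v ∈ (Fib f y).E p, ∃ z ∈ app (kk k) v,
      z ∈ (Id (Fib f y) p (center y)).E ⟨unique y p⟩ := fun _ v _ => ⟨k, mem_kk_app k v, trivial⟩
  have key : ∀ y, ∀ v ∈ Y.E y, ∃ z ∈ app (isEquivRealizer r) v,
      z ∈ (IsContr (Fib f y)).E ⟨center y, fun p => ⟨unique y p⟩, kk k, hc y⟩ := by
    intro y v hv
    obtain ⟨x, hx, hx'⟩ := hr y v hv
    obtain ⟨p, hp, hpx, hpk⟩ := pairConst_spec r k hx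
    obtain ⟨q, hq, hqp, hqk⟩ := pairConst_spec (pairConst r k) (kk k) hp
    exact ⟨q, hq, ⟨p, hqp, ⟨x, hpx, hx'⟩, k, hpk, trivial⟩, kk k, hqk, hc y⟩
  exact ⟨⟨_, _, key⟩, key⟩

/-- The realizer of equivalences that are tracked in both directions by the identity. -/
noncomputable def idEquivRealizer (𝔸 : Type u) [PCA 𝔸] : 𝔸 := pair (i 𝔸) (isEquivRealizer (i 𝔸))

/-- A bijection that preserves and reflects realizers is an equivalence. -/
theorem equiv_realizedBy {X : Assembly.{u, a} 𝔸} {Y : Assembly.{u, b} 𝔸} (e : X ≃ Y)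
    (he : ∀ x, Y.E (e x) = X.E x) : (Equiv X Y).RealizedBy (idEquivRealizer 𝔸) := by
  have hf : ∀ x, ∀ v ∈ X.E x, ∃ y ∈ app (i 𝔸) v, y ∈ Y.E (e x) :=
    fun x v hv => ⟨v, mem_i_app v, (he x).symm ▸ hv⟩
  refine RealizedBy.sigma ⟨e, _, hf⟩ hf
    (isEquiv_realizedBy _ e.symm e.apply_symm_apply e.symm_apply_apply fun y v hv => ?_)
  refine ⟨v, mem_i_app v, ?_⟩
  rw [← he, e.apply_symm_apply]
  exact hv

/-- Both points lie in the fiber over `f x`, hence equal its center. -/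
theorem Equiv.injective {X : Assembly.{u, a} 𝔸} {Y : Assembly.{u, b} 𝔸} (e : Equiv X Y) :
    Function.Injective e.1.1 := by
  obtain ⟨f, h⟩ := e
  intro x x' hxx'
  let p : Fib f (f x) := ⟨x, ⟨rfl⟩⟩
  let p' : Fib f (f x) := ⟨x', ⟨hxx'.symm⟩⟩
  have hp : p = p' := ((h.1 (f x)).2.1 p).down.trans ((h.1 (f x)).2.1 p').down.symm
  exact congrArg (fun q : Fib f (f x) => q.1) hp

/-! ### Resizing -/

/-- A copy of an assembly in another universe. -/
noncomputable def shrink (X : Assembly.{u, a} 𝔸) [Small.{w} X.carrier] : Assembly.{u, w} 𝔸 where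
  carrier := Shrink.{w} X.carrier
  E x := X.E ((equivShrink X.carrier).symm x)
  E_nonempty _ := X.E_nonempty _

theorem equiv_shrink_realizedBy (X : Assembly.{u, a} 𝔸) [Small.{w} X.carrier] :
    (Equiv (shrink.{u, a, w} X) X).RealizedBy (idEquivRealizer 𝔸) :=
  equiv_realizedBy (equivShrink X.carrier).symm fun _ => rfl

/-! ### Modest assemblies -/

/-- An assembly is modest if every realizer realizes at most one element. -/
def Modest (X : Assembly.{u, a} 𝔸) : Prop := ∀ ⦃x y r⦄, r ∈ X.E x → r ∈ X.E y → x = y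

theorem modest_modestSet (R : PER 𝔸) : R.modestSet.Modest := by
  rintro x y r ⟨h, rfl⟩ ⟨_, rfl⟩
  rfl

theorem modest_id (X : Assembly.{u, a} 𝔸) (x y : X) : (Id X x y).Modest := by
  rintro ⟨_⟩ ⟨_⟩ _ _ _
  rfl

/-- Every `x` has a realizer `v`, and the single value `r·v` pins down the section at `x`; nothing
is needed of `X`. -/
theorem modest_pi {X : Assembly.{u, a} 𝔸} {Y : X → Assembly.{u, b} 𝔸}
    (h : ∀ x, (Y x).Modest) : (Pi X Y).Modest := by
  intro f g r hf hg
  refine Subtype.ext (funext fun x => ?_)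
  obtain ⟨v, hv⟩ := X.E_nonempty x
  obtain ⟨y, hy, hy'⟩ := hf x v hv
  obtain ⟨z, hz, hz'⟩ := hg x v hv
  obtain rfl := Part.mem_unique hy hz
  exact h x hy' hz'

theorem Modest.of_injective {X : Assembly.{u, a} 𝔸} {Y : Assembly.{u, b} 𝔸} (hY : Y.Modest)
    (f : Fun X Y) (hf : Function.Injective f.1) : X.Modest := by
  intro x x' v hx hx'
  obtain ⟨r, hr⟩ := f.2
  obtain ⟨y, hy, hyx⟩ := hr x v hx
  obtain ⟨y', hy', hyx'⟩ := hr x' v hx'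
  obtain rfl := Part.mem_unique hy hy'
  exact hf (hY hyx hyx')

/-- The contraction data are tracked, so a realizer shared by `y` and `y'` yields one shared by the
centers of their fibers. These agree in `X`, and `f` maps them to `y` and `y'`. -/
theorem Modest.of_equiv {X : Assembly.{u, a} 𝔸} {Y : Assembly.{u, b} 𝔸} (hX : X.Modest)
    (e : Equiv X Y) : Y.Modest := by
  intro y y' v hy hy'
  obtain ⟨r, hr⟩ := e.2.2
  obtain ⟨c, hc, ⟨p, hp, ⟨x, hx, hxy⟩, -⟩, -⟩ := hr y v hy
  obtain ⟨c', hc', ⟨p', hp', ⟨x', hx', hxy'⟩, -⟩, -⟩ := hr y' v hy'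
  obtain rfl := Part.mem_unique hc hc'
  obtain rfl := Part.mem_unique hp hp'
  obtain rfl := Part.mem_unique hx hx'
  have h : (e.2.1 y).1.1 = (e.2.1 y').1.1 := hX hxy hxy'
  rw [← (e.2.1 y).1.2.down, ← (e.2.1 y').1.2.down, h]

/-! ### The modest reflection -/

/-- Two elements are linked if they share a realizer. -/
def Linked (X : Assembly.{u, a} 𝔸) (x y : X) : Prop := ∃ r, r ∈ X.E x ∧ r ∈ X.E y

/-- A tracker of `f` turns a realizer shared by two elements into one shared by their images. -/
theorem Modest.eq_of_eqvGen {X : Assembly.{u, a} 𝔸} {Y : Assembly.{u, b} 𝔸} (hY : Y.Modest)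
    (f : Fun X Y) {x y : X} (h : Relation.EqvGen X.Linked x y) : f x = f y := by
  induction h with
  | rel x y h =>
    obtain ⟨v, hx, hy⟩ := h
    obtain ⟨r, hr⟩ := f.2
    obtain ⟨z, hz, hzx⟩ := hr x v hx
    obtain ⟨z', hz', hzy⟩ := hr y v hy
    obtain rfl := Part.mem_unique hz hz'
    exact hY hzx hzy
  | refl => rfl
  | symm _ _ _ ih => exact ih.symm
  | trans _ _ _ _ _ ih ih' => exact ih.trans ih'

/-- The partial equivalence relation generated by sharing an element. -/
def toPER (X : Assembly.{u, a} 𝔸) : PER 𝔸 where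
  rel r t := ∃ x y, r ∈ X.E x ∧ t ∈ X.E y ∧ Relation.EqvGen X.Linked x y
  symm := fun ⟨x, y, hx, hy, h⟩ => ⟨y, x, hy, hx, h.symm⟩
  -- The middle realizer may witness different elements in the two hypotheses; they share it, so
  -- they are linked and the two chains join.
  trans := fun ⟨x, _, hx, hy, h⟩ ⟨_, z, hy', hz, h'⟩ =>
    ⟨x, z, hx, hz, (h.trans _ _ _ (.rel _ _ ⟨_, hy, hy'⟩)).trans _ _ _ h'⟩

theorem toPER_rel {X : Assembly.{u, a} 𝔸} {x : X} {r t : 𝔸} (hr : r ∈ X.E x) (ht : t ∈ X.E x) :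
    X.toPER.rel r t := ⟨x, x, hr, ht, .refl x⟩

/-- The class of the realizers of an element. -/
noncomputable def unitFun (X : Assembly.{u, a} 𝔸) (x : X) : X.toPER.modestSet :=
  Quotient.mk X.toPER.setoid ⟨(X.E_nonempty x).some,
    toPER_rel (X.E_nonempty x).some_mem (X.E_nonempty x).some_mem⟩

theorem mem_unitFun {X : Assembly.{u, a} 𝔸} {x : X} {v : 𝔸} (hv : v ∈ X.E x) :
    v ∈ X.toPER.modestSet.E (X.unitFun x) :=
  ⟨toPER_rel hv hv, Quotient.sound (toPER_rel hv (X.E_nonempty x).some_mem)⟩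

theorem unitFun_realizer (X : Assembly.{u, a} 𝔸) :
    ∀ x, ∀ v ∈ X.E x, ∃ y ∈ app (i 𝔸) v, y ∈ X.toPER.modestSet.E (X.unitFun x) :=
  fun _ v hv => ⟨v, mem_i_app v, mem_unitFun hv⟩

/-- The unit of the modest reflection. -/
noncomputable def unit (X : Assembly.{u, a} 𝔸) : Fun X X.toPER.modestSet :=
  ⟨X.unitFun, i 𝔸, X.unitFun_realizer⟩

/-- A function is a modest quotient if every realizer of its codomain realizes a preimage, and it
identifies only elements that are connected by shared realizers. -/
structure IsModestQuotient {X : Assembly.{u, a} 𝔸} {M : Assembly.{u, b} 𝔸} (η : X → M) :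
    Prop where
  exists_preimage : ∀ m, ∀ v ∈ M.E m, ∃ x, η x = m ∧ v ∈ X.E x
  eqvGen : ∀ x y, η x = η y → Relation.EqvGen X.Linked x y

theorem isModestQuotient_unit (X : Assembly.{u, a} 𝔸) : IsModestQuotient X.unit.1 where
  exists_preimage := by
    rintro m v ⟨⟨x, _, hx, -⟩, rfl⟩
    exact ⟨x, Quotient.sound (toPER_rel (X.E_nonempty x).some_mem hx), hx⟩
  eqvGen x y h := by
    -- The witnesses `x'`, `y'` need not be `x`, `y`, but share the chosen realizers with them,
    -- which adds a link at each end.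
    obtain ⟨x', y', hx', hy', h'⟩ := Quotient.exact h
    exact ((Relation.EqvGen.rel _ _ ⟨_, (X.E_nonempty x).some_mem, hx'⟩).trans _ _ _ h').trans
      _ _ _ (.rel _ _ ⟨_, hy', (X.E_nonempty y).some_mem⟩)

namespace IsModestQuotient

variable {X : Assembly.{u, a} 𝔸} {M : Assembly.{u, b} 𝔸}

theorem surjective {η : X → M} (h : IsModestQuotient η) : Function.Surjective η := by
  intro m
  obtain ⟨v, hv⟩ := M.E_nonempty m
  obtain ⟨x, hx, -⟩ := h.exists_preimage m v hv
  exact ⟨x, hx⟩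

/-- A realizer of `m` already realizes some preimage, and `f` does not distinguish it from the
chosen one. Hence `r` tracks the extension unchanged. -/
theorem extend_realizer {η : X → M} (h : IsModestQuotient η) {B : Assembly.{u, c} 𝔸}
    (hB : B.Modest) (f : Fun X B) {r : 𝔸} (hr : r ∈ (Fun X B).E f) :
    ∀ m, ∀ v ∈ M.E m, ∃ y ∈ app r v, y ∈ B.E (f (Function.surjInv h.surjective m)) := by
  intro m v hv
  obtain ⟨x, hx, hxv⟩ := h.exists_preimage m v hv
  obtain ⟨y, hy, hyx⟩ := hr x v hxv
  refine ⟨y, hy, ?_⟩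
  rwa [hB.eq_of_eqvGen f (h.eqvGen _ x ((Function.surjInv_eq h.surjective m).trans hx.symm))]

/-- The extension of a function into a modest assembly along a modest quotient. -/
noncomputable def extend {η : X → M} (h : IsModestQuotient η) {B : Assembly.{u, c} 𝔸}
    (hB : B.Modest) (f : Fun X B) : Fun M B :=
  ⟨fun m => f (Function.surjInv h.surjective m), f.2.imp fun _ => h.extend_realizer hB f⟩

theorem extend_apply {η : X → M} (h : IsModestQuotient η) {B : Assembly.{u, c} 𝔸}
    (hB : B.Modest) (f : Fun X B) (x : X) : h.extend hB f (η x) = f x :=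
  hB.eq_of_eqvGen f (h.eqvGen _ _ (Function.surjInv_eq h.surjective _))

/-- The inverse is `extend`, tracked by `i` because it preserves realizers; uniqueness of extensions
is surjectivity of `η`. -/
theorem precomp_isEquiv_realizedBy {η : Fun X M} (h : IsModestQuotient η.1)
    {B : Assembly.{u, c} 𝔸} (hB : B.Modest) :
    (IsEquiv (precomp η B)).RealizedBy (isEquivRealizer (i 𝔸)) := by
  refine isEquiv_realizedBy _ (h.extend hB) (fun f => Subtype.ext (funext (h.extend_apply hB f)))
    (fun f => Subtype.ext (funext fun m => ?_))
    (fun f r hr => ⟨r, mem_i_app r, h.extend_realizer hB f hr⟩)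
  obtain ⟨x, rfl⟩ := h.surjective m
  exact h.extend_apply hB (precomp η B f) x

end IsModestQuotient

theorem Modest.equiv_realizedBy {X : Assembly.{u, a} 𝔸} (hX : X.Modest) :
    (Equiv X.toPER.modestSet X).RealizedBy (idEquivRealizer 𝔸) := by
  -- Applying `Modest.eq_of_eqvGen` to the identity morphism shows that linking generates only
  -- equality.
  have hinj : Function.Injective X.unit.1 := fun x y h =>
    hX.eq_of_eqvGen ⟨_root_.id, i 𝔸, fun _ v hv => ⟨v, mem_i_app v, hv⟩⟩
      (X.isModestQuotient_unit.eqvGen x y h)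
  refine Assembly.equiv_realizedBy
    (_root_.Equiv.ofBijective X.unit.1 ⟨hinj, X.isModestQuotient_unit.surjective⟩).symm fun m => ?_
  obtain ⟨x, rfl⟩ := X.isModestQuotient_unit.surjective m
  refine (congrArg X.E (_root_.Equiv.ofBijective_symm_apply_apply X.unit.1 _ x)).trans ?_
  refine Set.Subset.antisymm (fun v hv => mem_unitFun hv) fun v hv => ?_
  obtain ⟨y, hy, hyv⟩ := X.isModestQuotient_unit.exists_preimage _ v hv
  rwa [← hinj hy]

end Assembly

open Assembly

/-! ### The universe of assemblies and the universe of partial equivalence relations -/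

instance [Small.{w} 𝔸] : Small.{w} (PER 𝔸) :=
  small_of_injective (f := PER.rel) fun R S h => by cases R; cases S; cases h; rfl

instance (R : PER 𝔸) [Small.{w} 𝔸] : Small.{w} R.modestSet.carrier :=
  inferInstanceAs (Small.{w} (Quotient R.setoid))

/-- The realizer of membership in a universe with trivially realized codes. -/
noncomputable def hasRealizer (𝔸 : Type u) [PCA 𝔸] : 𝔸 := pair k (idEquivRealizer 𝔸)

theorem asmUniv_has_of_small (X : Assembly.{u, a} 𝔸) [Small.{w} X.carrier] :
    ((asmUniv.{u, w} 𝔸).Has X).RealizedBy (hasRealizer 𝔸) :=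
  RealizedBy.sigma (X := (asmUniv.{u, w} 𝔸).ty) (shrink.{u, a, w} X) trivial
    (equiv_shrink_realizedBy X)

theorem Assembly.Modest.perUniv_has {X : Assembly.{u, a} 𝔸} (hX : X.Modest) :
    ((perUniv 𝔸).Has X).RealizedBy (hasRealizer 𝔸) :=
  RealizedBy.sigma (X := (perUniv 𝔸).ty) X.toPER trivial hX.equiv_realizedBy

theorem modest_of_perUniv_has {X : Assembly.{u, a} 𝔸} (h : (perUniv 𝔸).Has X) : X.Modest :=
  (modest_modestSet h.1).of_equiv h.2

theorem memPred_realizedBy {A : Assembly.{u, w} 𝔸} (hA : A.Modest) :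
    ((perUniv 𝔸).memPred (asmUniv.{u, w} 𝔸) A).RealizedBy (hasRealizer 𝔸) := by
  obtain ⟨x, hx⟩ := hA.perUniv_has
  exact ⟨⟨⟨x⟩⟩, x, hx⟩

theorem modest_of_memPred {A : Assembly.{u, w} 𝔸}
    (h : (perUniv 𝔸).memPred (asmUniv.{u, w} 𝔸) A) : A.Modest :=
  h.down.elim modest_of_perUniv_has

theorem asmUniv_has_perUniv [Small.{w} 𝔸] :
    ((asmUniv.{u, w} 𝔸).Has (perUniv 𝔸).ty).Holds :=
  haveI : Small.{w} (perUniv 𝔸).ty.carrier := inferInstanceAs (Small.{w} (PER 𝔸))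
  (asmUniv_has_of_small _).holds

theorem perUniv_subset_asmUniv [Small.{w} 𝔸] :
    ((perUniv 𝔸).Subset (asmUniv.{u, w} 𝔸)).Holds :=
  (RealizedBy.pi fun R : PER 𝔸 => asmUniv_has_of_small R.modestSet).holds

theorem perUniv_closedUnderId : (perUniv 𝔸).ClosedUnderId.Holds :=
  (RealizedBy.pi fun R : PER 𝔸 => RealizedBy.pi fun x : R.modestSet =>
    RealizedBy.pi fun y : R.modestSet => (modest_id R.modestSet x y).perUniv_has).holds

theorem perUniv_universalTypes : ((perUniv 𝔸).UniversalTypes (asmUniv.{u, w} 𝔸)).Holds :=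
  (RealizedBy.pi fun A : Assembly.{u, w} 𝔸 => RealizedBy.pi fun B : Fun A (perUniv 𝔸).ty =>
    (modest_pi fun x : A => modest_modestSet (B.1 x)).perUniv_has).holds

theorem asmUniv_closedUnderSigma : (asmUniv.{u, w} 𝔸).ClosedUnderSigma.Holds :=
  (RealizedBy.pi fun A : Assembly.{u, w} 𝔸 => RealizedBy.pi
    fun B : Fun A (asmUniv.{u, w} 𝔸).ty => asmUniv_has_of_small (Sigma A B.1)).holds

theorem asmUniv_universalTypes : ((asmUniv.{u, w} 𝔸).UniversalTypes (asmUniv.{u, w} 𝔸)).Holds :=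
  (RealizedBy.pi fun A : Assembly.{u, w} 𝔸 => RealizedBy.pi
    fun B : Fun A (asmUniv.{u, w} 𝔸).ty => asmUniv_has_of_small (Pi A B.1)).holds

theorem memPred_isSubuniverse :
    ((asmUniv.{u, w} 𝔸).IsSubuniverse ((perUniv 𝔸).memPred (asmUniv.{u, w} 𝔸))).Holds := by
  have h₁ : (Pi (asmUniv.{u, w} 𝔸).ty fun A =>
      IsProp ((perUniv 𝔸).memPred (asmUniv.{u, w} 𝔸) A)).RealizedBy (kk (kk (kk k))) :=
    RealizedBy.pi fun _ => RealizedBy.pi fun ⟨_⟩ => RealizedBy.pi fun ⟨_⟩ => RealizedBy.id rfl k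
  have h₂ := RealizedBy.pi fun A : (asmUniv.{u, w} 𝔸).ty =>
    RealizedBy.pi fun B : (asmUniv.{u, w} 𝔸).ty =>
    RealizedBy.pi fun e : Assembly.Equiv ((asmUniv.{u, w} 𝔸).El A) ((asmUniv.{u, w} 𝔸).El B) =>
    RealizedBy.pi fun h : (perUniv 𝔸).memPred (asmUniv.{u, w} 𝔸) B =>
      -- Repleteness needs only that `e` embeds `A` in a modest assembly; the realizers of `e` and
      -- `h` are discarded.
      memPred_realizedBy ((modest_of_memPred h).of_injective e.1 (Assembly.Equiv.injective e))
  obtain ⟨x, -⟩ := h₁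
  obtain ⟨y, -⟩ := h₂
  exact Holds.of_element ⟨x, y⟩

theorem perUniv_reflective : ((perUniv 𝔸).Reflective (asmUniv.{u, w} 𝔸)).Holds :=
  (RealizedBy.pi fun A : Assembly.{u, w} 𝔸 =>
    RealizedBy.sigma (X := (perUniv 𝔸).ty) (r := k) A.toPER trivial <|
    RealizedBy.sigma A.unit A.unitFun_realizer <|
    RealizedBy.pi fun B : PER 𝔸 => A.isModestQuotient_unit.precomp_isEquiv_realizedBy
      (B := B.modestSet) (modest_modestSet B)).holds

/-- The reflection lives in the universe of `𝔸`; a resized copy is needed for it to be a code of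
`asmUniv`. Resizing keeps the realizers, so it is still a modest quotient. -/
theorem exists_modestQuotient [Small.{w} 𝔸] (A : Assembly.{u, a} 𝔸) :
    ∃ (M : Assembly.{u, w} 𝔸) (η : Fun A M), M.Modest ∧ i 𝔸 ∈ (Fun A M).E η ∧
      IsModestQuotient η.1 := by
  let e := equivShrink.{w} A.toPER.modestSet.carrier
  have hη : ∀ x, ∀ v ∈ A.E x, ∃ y ∈ app (i 𝔸) v,
      y ∈ (shrink.{u, u, w} A.toPER.modestSet).E (e (A.unitFun x)) := fun x v hv =>
    ⟨v, mem_i_app v, by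
      change v ∈ A.toPER.modestSet.E (e.symm (e (A.unitFun x)))
      rw [e.symm_apply_apply]
      exact mem_unitFun hv⟩
  refine ⟨shrink.{u, u, w} A.toPER.modestSet, ⟨fun x => e (A.unitFun x), i 𝔸, hη⟩,
    fun x y r hx hy => e.symm.injective (modest_modestSet _ hx hy), hη, fun m v hv => ?_,
    fun x y h => A.isModestQuotient_unit.eqvGen x y (e.injective h)⟩
  obtain ⟨x, hx, hxv⟩ := A.isModestQuotient_unit.exists_preimage _ v hv
  exact ⟨x, (congrArg e hx).trans (e.apply_symm_apply m), hxv⟩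

theorem sub_memPred_reflective [Small.{w} 𝔸] :
    (((asmUniv.{u, w} 𝔸).sub ((perUniv 𝔸).memPred (asmUniv.{u, w} 𝔸))).Reflective
      (asmUniv.{u, w} 𝔸)).Holds := by
  -- The components realize the code with its membership proof, the unit, and the universal
  -- property; none depends on `A`.
  refine (RealizedBy.pi (r := pair (pair k (hasRealizer 𝔸))
    (pair (i 𝔸) (kk (isEquivRealizer (i 𝔸))))) fun A : Assembly.{u, w} 𝔸 => ?_).holds
  obtain ⟨M, η, hM, hη, h⟩ := exists_modestQuotient.{u, w, w} A
  obtain ⟨c, hc⟩ := memPred_realizedBy hM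
  exact RealizedBy.sigma
    (X := ((asmUniv.{u, w} 𝔸).sub ((perUniv 𝔸).memPred (asmUniv.{u, w} 𝔸))).ty) ⟨M, c⟩
    ⟨⟨k, mem_pair_fst _ _, trivial⟩, _, mem_pair_snd _ _, hc⟩ <|
    RealizedBy.sigma η hη <| RealizedBy.pi fun B =>
      h.precomp_isEquiv_realizedBy (modest_of_memPred B.2)

/-- Here `bind` is extension along the unit: computation is `extend_apply`, and extensionality is
surjectivity of the unit. -/
theorem perUniv_modalRules : ((perUniv 𝔸).ModalRules (asmUniv.{u, w} 𝔸)).Holds := by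
  let bind (A : Assembly.{u, w} 𝔸) (C : PER 𝔸) (v : Fun A C.modestSet) :
      Fun A.toPER.modestSet C.modestSet := A.isModestQuotient_unit.extend (modest_modestSet C) v
  have hbind (A : Assembly.{u, w} 𝔸) (C : PER 𝔸) :
      ∀ v, ∀ r ∈ (Fun A C.modestSet).E v, ∃ t ∈ app (i 𝔸) r, t ∈ (Fun _ _).E (bind A C v) :=
    fun v r hr => ⟨r, mem_i_app r, A.isModestQuotient_unit.extend_realizer (modest_modestSet C) v hr⟩
  refine Holds.of_element ⟨⟨fun A => A.toPER, kk k, ?_⟩, ⟨fun A => A.unit, kk (i 𝔸), ?_⟩,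
    ⟨fun A => ⟨fun C => ⟨bind A C, i 𝔸, hbind A C⟩, kk (i 𝔸), ?_⟩, kk (kk (i 𝔸)), ?_⟩, ?_, ?_⟩
  · exact fun _ v _ => ⟨k, mem_kk_app k v, trivial⟩
  · exact fun A v _ => ⟨i 𝔸, mem_kk_app _ v, A.unitFun_realizer⟩
  · exact fun C v _ => ⟨i 𝔸, mem_kk_app _ v, hbind A C⟩
  · exact fun A v _ => ⟨kk (i 𝔸), mem_kk_app _ v,
      fun C v' _ => ⟨i 𝔸, mem_kk_app _ v', hbind A C⟩⟩
  · exact (RealizedBy.pi fun A : Assembly.{u, w} 𝔸 => RealizedBy.pi fun C : PER 𝔸 =>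
      RealizedBy.pi fun v : Fun A C.modestSet => RealizedBy.pi fun x : A => RealizedBy.id
        (A.isModestQuotient_unit.extend_apply (modest_modestSet C) v x) k).choose
  · have hext (A : Assembly.{u, w} 𝔸) (C : PER 𝔸) (f g : Fun A.toPER.modestSet C.modestSet)
        (h : Pi A fun x => Id C.modestSet (f (A.unit x)) (g (A.unit x)))
        (z : A.toPER.modestSet) : f z = g z := by
      obtain ⟨x, rfl⟩ := A.isModestQuotient_unit.surjective z
      exact (h x).down
    exact (RealizedBy.pi fun A : Assembly.{u, w} 𝔸 => RealizedBy.pi fun C : PER 𝔸 =>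
      RealizedBy.pi fun f : Fun A.toPER.modestSet C.modestSet =>
      RealizedBy.pi fun g : Fun A.toPER.modestSet C.modestSet =>
      RealizedBy.pi fun h : Pi A fun x => Id C.modestSet (f (A.unit x)) (g (A.unit x)) =>
      RealizedBy.pi fun z : A.toPER.modestSet => RealizedBy.id (hext A C f g h z) k).choose

end Realizability

theorem mainTheorem3 (𝔸 : Type u) [Realizability.PCA 𝔸] [Small.{w} 𝔸] :
    ((Realizability.asmUniv.{u, w} 𝔸).Has (Realizability.perUniv 𝔸).ty).Holds ∧
    ((Realizability.perUniv 𝔸).Subset (Realizability.asmUniv.{u, w} 𝔸)).Holds ∧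
    (Realizability.perUniv 𝔸).ClosedUnderId.Holds ∧
    ((Realizability.perUniv 𝔸).UniversalTypes (Realizability.asmUniv.{u, w} 𝔸)).Holds ∧
    (Realizability.perUniv 𝔸).IsSmallReflectiveSubuniverse (Realizability.asmUniv.{u, w} 𝔸) ∧
    (Realizability.perUniv 𝔸).ModelsFirstClassModules (Realizability.asmUniv.{u, w} 𝔸) := by
  open Realizability in
  exact ⟨asmUniv_has_perUniv, perUniv_subset_asmUniv, perUniv_closedUnderId,
    perUniv_universalTypes,
    ⟨asmUniv_has_perUniv, perUniv_subset_asmUniv, memPred_isSubuniverse, perUniv_reflective,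
      sub_memPred_reflective⟩,
    ⟨asmUniv_has_perUniv, perUniv_subset_asmUniv, asmUniv_closedUnderSigma,
      asmUniv_universalTypes, perUniv_modalRules⟩⟩
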